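/- Let $X$ be a locally compact Hausdorff space, $\alpha:X\to X$ a homeomorphism, and $W=(w_j)_{j\in\mathbb Z}$ a sequence in $C_b(X)$ (bounded continuous complex-valued functions) with $\sup_{j}\|w_j\|_\infty<\infty$. Let $\ell^2(C_0(X))$ be the standard Hilbert module over $C_0(X)$, that is, the space of sequences $a=(a_j)_{j\in\mathbb Z}$ in $C_0(X)$ for which $\sum_j a_j^*a_j$ converges in norm, with $\|a\|_2=\|\sum_j a_j^*a_j\|_\infty^{1/2}$, and let $T_{\alpha,W}$ be the bounded operator on it given by $$(T_{\alpha,W}\,a)_j=w_j\cdot(a_{j-1}\circ\alpha)\qquad(j\in\mathbb Z).$$ Consider the following statements. 1. $T_{\alpha,W}$ is hypercyclic, i.e. there is $a\in\ell^2(C_0(X))$ whose orbit $\{T_{\alpha,W}^n a: n\ge 0\}$ is dense. 2. For every non-empty compact $K\subseteq X$ and every non-empty finite set $I\subset\mathbb N=\{1,2,\dots\}$ there is a strictly increasing sequence $(r_k)_k$ in $\mathbb N$ such that for every $j\in I$ $$\lim_{k\to\infty}\ \sup_{t\in K}\prod_{i=1}^{r_k}\bigl|w_{i+j}(\alpha^{-i}(t))\bigr|=0\quad\text{and}\quad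 \lim_{k\to\infty}\ \sup_{t\in K}\prod_{i=1}^{r_k}\bigl|w_{j+1-i}(\alpha^{i-1}(t))\bigr|^{-1}=0,$$ where $|0|^{-1}=\infty$ (so the second limit requires that the factors that occur do not vanish on $K$ for large $k$). Then (1) implies (2). Conversely, if $\ell^2(C_0(X))$ is separable, $w_j(x)>0$ for all $j\in\mathbb Z$ and $x\in X$, and $\sup_{j}\|w_j^{-1}\|_\infty<\infty$, then (2) implies (1). -/

import Mathlib

open scoped ZeroAtInfty BoundedContinuousFunction ComplexOrder

noncomputable section

namespace HilbertShift

variable {X : Type*} [TopologicalSpace X]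

/-! ### The standard Hilbert module `ℓ²(C₀(X))` -/

theorem sum_apply {ι : Type*} (t : Finset ι) (f : ι → C₀(X, ℂ)) (x : X) :
    (∑ j ∈ t, f j) x = ∑ j ∈ t, f j x := by
  classical
  induction t using Finset.induction_on with
  | empty => simp
  | insert i s hi ih => simp [Finset.sum_insert hi, ih]

theorem star_mul_self_apply (f : C₀(X, ℂ)) (x : X) :
    (star f * f) x = ((‖f x‖ ^ 2 : ℝ) : ℂ) := by
  simp [Complex.conj_mul']

theorem norm_apply_le (f : C₀(X, ℂ)) (x : X) : ‖f x‖ ≤ ‖f‖ :=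
  f.toBCF.norm_coe_le_norm x

theorem norm_le_of_forall {f : C₀(X, ℂ)} {C : ℝ} (hC : 0 ≤ C) (h : ∀ x, ‖f x‖ ≤ C) : ‖f‖ ≤ C :=
  (BoundedContinuousFunction.norm_le (f := f.toBCF) hC).2 h

theorem norm_sum_star_mul_self_apply (t : Finset ℤ) (a : ℤ → C₀(X, ℂ)) (x : X) :
    ‖(∑ j ∈ t, star (a j) * a j) x‖ = ∑ j ∈ t, ‖a j x‖ ^ 2 := by
  rw [sum_apply]
  simp_rw [star_mul_self_apply]
  rw [← Complex.ofReal_sum, Complex.norm_real, Real.norm_eq_abs,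
    abs_of_nonneg (Finset.sum_nonneg fun _ _ => sq_nonneg _)]

theorem summable_of_norm_sum_le {f g h : ℤ → C₀(X, ℂ)} {C : ℝ} (hC : 0 < C)
    (hf : Summable f) (hg : Summable g)
    (hle : ∀ t : Finset ℤ, ‖∑ j ∈ t, h j‖ ≤ C * (‖∑ j ∈ t, f j‖ + ‖∑ j ∈ t, g j‖)) :
    Summable h := by
  classical
  rw [summable_iff_vanishing_norm] at *
  intro ε hε
  obtain ⟨s₁, h₁⟩ := hf (ε / (2 * C)) (by positivity)
  obtain ⟨s₂, h₂⟩ := hg (ε / (2 * C)) (by positivity)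
  refine ⟨s₁ ∪ s₂, fun t ht => (hle t).trans_lt ?_⟩
  rw [Finset.disjoint_union_right] at ht
  calc C * (‖∑ j ∈ t, f j‖ + ‖∑ j ∈ t, g j‖)
      < C * (ε / (2 * C) + ε / (2 * C)) :=
        mul_lt_mul_of_pos_left (add_lt_add (h₁ t ht.1) (h₂ t ht.2)) hC
    _ = ε := by field_simp; ring

variable (X) in
/-- The sequences `(a_j)_{j ∈ ℤ}` in `C₀(X)` for which `∑ a_j^* a_j` converges in norm. -/
def squareSummable : Submodule ℂ (ℤ → C₀(X, ℂ)) where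
  carrier := {a | Summable fun j => star (a j) * a j}
  zero_mem' := by simp
  add_mem' := by
    intro a b ha hb
    refine summable_of_norm_sum_le (C := 2) two_pos ha hb fun t => ?_
    refine norm_le_of_forall (by positivity) fun x => ?_
    have h₁ := norm_apply_le (∑ j ∈ t, star (a j) * a j) x
    have h₂ := norm_apply_le (∑ j ∈ t, star (b j) * b j) x
    have h₃ := norm_sum_star_mul_self_apply t (a + b) x
    rw [norm_sum_star_mul_self_apply] at h₁ h₂
    rw [h₃]
    calc ∑ j ∈ t, ‖(a + b) j x‖ ^ 2 ≤ ∑ j ∈ t, 2 * (‖a j x‖ ^ 2 + ‖b j x‖ ^ 2) := by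
          refine Finset.sum_le_sum fun j _ => ?_
          have h := norm_add_le (a j x) (b j x)
          have h' : ‖(a + b) j x‖ ≤ ‖a j x‖ + ‖b j x‖ := h
          nlinarith [norm_nonneg ((a + b) j x), sq_nonneg (‖a j x‖ - ‖b j x‖)]
      _ = 2 * (∑ j ∈ t, ‖a j x‖ ^ 2 + ∑ j ∈ t, ‖b j x‖ ^ 2) := by
          rw [← Finset.mul_sum, Finset.sum_add_distrib]
      _ ≤ _ := by gcongr
  smul_mem' := by
    intro c a ha
    have h : (fun j => star ((c • a) j) * (c • a) j)
        = fun j => (star c * c) • (star (a j) * a j) := by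
      funext j
      ext x
      simp
      ring
    change Summable _
    rw [h]
    exact Summable.const_smul _ ha

variable (X) in
/-- The standard Hilbert module `ℓ²(C₀(X))`. It is a type synonym, so that its topology is the one
of the norm below and not that of coordinatewise convergence. -/
def EllTwo : Type _ := ↥(squareSummable X)

namespace EllTwo

instance : AddCommGroup (EllTwo X) := inferInstanceAs (AddCommGroup ↥(squareSummable X))
instance : Module ℂ (EllTwo X) := inferInstanceAs (Module ℂ ↥(squareSummable X))

/-- The `j`-th entry of an element of `ℓ²(C₀(X))`. -/
def coord (a : EllTwo X) (j : ℤ) : C₀(X, ℂ) := a.1 j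

/-- The element of `ℓ²(C₀(X))` with given entries. -/
def mk (a : ℤ → C₀(X, ℂ)) (ha : Summable fun j => star (a j) * a j) : EllTwo X := ⟨a, ha⟩

@[simp] theorem coord_mk (a : ℤ → C₀(X, ℂ)) (ha) (j : ℤ) : (mk a ha).coord j = a j := rfl
@[simp] theorem coord_zero (j : ℤ) : (0 : EllTwo X).coord j = 0 := rfl
@[simp] theorem coord_add (a b : EllTwo X) (j : ℤ) :
    (a + b).coord j = a.coord j + b.coord j := rfl
@[simp] theorem coord_neg (a : EllTwo X) (j : ℤ) : (-a).coord j = -a.coord j := rfl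
@[simp] theorem coord_smul (c : ℂ) (a : EllTwo X) (j : ℤ) :
    (c • a).coord j = c • a.coord j := rfl

@[ext] theorem ext {a b : EllTwo X} (h : ∀ j, a.coord j = b.coord j) : a = b :=
  Subtype.ext (funext h)

theorem summable (a : EllTwo X) : Summable fun j => star (a.coord j) * a.coord j := a.2

/-- The Hilbert module norm `‖a‖₂ = ‖∑ a_j^* a_j‖^{1/2}`. -/
instance : Norm (EllTwo X) := ⟨fun a => √‖∑' j, star (a.coord j) * a.coord j‖⟩

theorem norm_def (a : EllTwo X) : ‖a‖ = √‖∑' j, star (a.coord j) * a.coord j‖ := rfl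

theorem hasSum_apply (a : EllTwo X) (x : X) :
    HasSum (fun j => ‖a.coord j x‖ ^ 2) ‖(∑' j, star (a.coord j) * a.coord j) x‖ := by
  have h := a.summable.hasSum
  have h' := (ZeroAtInftyContinuousMap.tendsto_iff_tendstoUniformly.1 h).tendsto_at x
  have h'' := h'.norm
  simp_rw [norm_sum_star_mul_self_apply] at h''
  exact h''

theorem norm_nonneg' (a : EllTwo X) : 0 ≤ ‖a‖ := Real.sqrt_nonneg _

theorem sum_sq_le (a : EllTwo X) (x : X) (t : Finset ℤ) :
    ∑ j ∈ t, ‖a.coord j x‖ ^ 2 ≤ ‖a‖ ^ 2 := by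
  rw [norm_def, Real.sq_sqrt (norm_nonneg _)]
  exact (sum_le_hasSum t (fun _ _ => sq_nonneg _) (a.hasSum_apply x)).trans (norm_apply_le _ x)

theorem norm_le {a : EllTwo X} {C : ℝ} (hC : 0 ≤ C)
    (h : ∀ (x : X) (t : Finset ℤ), ∑ j ∈ t, ‖a.coord j x‖ ^ 2 ≤ C ^ 2) : ‖a‖ ≤ C := by
  rw [norm_def]
  refine Real.sqrt_le_iff.2 ⟨hC, norm_le_of_forall (sq_nonneg _) fun x => ?_⟩
  exact hasSum_le_of_sum_le (a.hasSum_apply x) (h x)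

theorem norm_coord_apply_le (a : EllTwo X) (j : ℤ) (x : X) : ‖a.coord j x‖ ≤ ‖a‖ := by
  have h := a.sum_sq_le x {j}
  rw [Finset.sum_singleton] at h
  exact le_of_abs_le ((sq_le_sq.1 h).trans_eq (abs_of_nonneg a.norm_nonneg'))

theorem norm_add_le' (a b : EllTwo X) : ‖a + b‖ ≤ ‖a‖ + ‖b‖ := by
  refine norm_le (add_nonneg a.norm_nonneg' b.norm_nonneg') fun x t => ?_
  have ha := a.sum_sq_le x t
  have hb := b.sum_sq_le x t
  have hab : ∑ j ∈ t, ‖a.coord j x‖ * ‖b.coord j x‖ ≤ ‖a‖ * ‖b‖ := by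
    refine abs_le_of_sq_le_sq' ?_ (mul_nonneg a.norm_nonneg' b.norm_nonneg') |>.2
    calc _ ≤ _ := Finset.sum_mul_sq_le_sq_mul_sq t _ _
      _ ≤ ‖a‖ ^ 2 * ‖b‖ ^ 2 :=
        mul_le_mul ha hb (Finset.sum_nonneg fun _ _ => sq_nonneg _) (sq_nonneg _)
      _ = _ := by ring
  calc ∑ j ∈ t, ‖(a + b).coord j x‖ ^ 2
      ≤ ∑ j ∈ t, (‖a.coord j x‖ ^ 2 + ‖b.coord j x‖ ^ 2
          + 2 * (‖a.coord j x‖ * ‖b.coord j x‖)) := by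
        refine Finset.sum_le_sum fun j _ => ?_
        have h : ‖(a + b).coord j x‖ ≤ ‖a.coord j x‖ + ‖b.coord j x‖ :=
          norm_add_le (a.coord j x) (b.coord j x)
        nlinarith [norm_nonneg ((a + b).coord j x)]
    _ = ∑ j ∈ t, ‖a.coord j x‖ ^ 2 + ∑ j ∈ t, ‖b.coord j x‖ ^ 2
          + 2 * ∑ j ∈ t, ‖a.coord j x‖ * ‖b.coord j x‖ := by
        rw [Finset.sum_add_distrib, Finset.sum_add_distrib, ← Finset.mul_sum]
    _ ≤ (‖a‖ + ‖b‖) ^ 2 := by nlinarith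

theorem norm_smul_le' (c : ℂ) (a : EllTwo X) : ‖c • a‖ ≤ ‖c‖ * ‖a‖ := by
  refine norm_le (mul_nonneg (norm_nonneg c) a.norm_nonneg') fun x t => ?_
  have ha := a.sum_sq_le x t
  have h : ∀ j, ‖(c • a).coord j x‖ ^ 2 = ‖c‖ ^ 2 * ‖a.coord j x‖ ^ 2 := fun j => by
    simp [mul_pow]
  simp_rw [h]
  rw [← Finset.mul_sum, mul_pow]
  exact mul_le_mul_of_nonneg_left ha (sq_nonneg _)

instance : NormedAddCommGroup (EllTwo X) :=
  AddGroupNorm.toNormedAddCommGroup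
    { toFun := fun a => ‖a‖
      map_zero' := le_antisymm (norm_le le_rfl fun x t => by simp) (norm_nonneg' _)
      add_le' := norm_add_le'
      neg' := fun a => by
        change ‖-a‖ = ‖a‖
        have h : ∀ j, star ((-a).coord j) * (-a).coord j = star (a.coord j) * a.coord j :=
          fun j => by
            ext x
            simp
        simp_rw [norm_def, h]
      eq_zero_of_map_eq_zero' := fun a ha => by
        ext j x
        have h := a.norm_coord_apply_le j x
        rw [show ‖a‖ = 0 from ha] at h
        simpa using norm_le_zero_iff.1 h }

instance : NormedSpace ℂ (EllTwo X) := ⟨norm_smul_le'⟩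

end EllTwo

/-! ### The operator `T_{α,W}` -/

/-- The product `w · f ∈ C₀(X)` of `w ∈ C_b(X)` and `f ∈ C₀(X)`. -/
def bmul (w : X →ᵇ ℂ) (f : C₀(X, ℂ)) : C₀(X, ℂ) where
  toFun x := w x * f x
  continuous_toFun := w.continuous.mul f.continuous
  zero_at_infty' := by
    have h : Filter.Tendsto (fun x => ‖w‖ * ‖f x‖) (Filter.cocompact X) (nhds 0) := by
      simpa using (ZeroAtInftyContinuousMapClass.zero_at_infty f).norm.const_mul ‖w‖
    refine squeeze_zero_norm (fun x => ?_) h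
    rw [norm_mul]
    exact mul_le_mul_of_nonneg_right (w.norm_coe_le_norm x) (norm_nonneg _)

@[simp] theorem bmul_apply (w : X →ᵇ ℂ) (f : C₀(X, ℂ)) (x : X) : bmul w f x = w x * f x := rfl

/-- `Φ_α(f) = f ∘ α` on `C₀(X)`. -/
def compHomeo (α : X ≃ₜ X) (f : C₀(X, ℂ)) : C₀(X, ℂ) := f.comp α.toCocompactMap

@[simp] theorem compHomeo_apply (α : X ≃ₜ X) (f : C₀(X, ℂ)) (x : X) :
    compHomeo α f x = f (α x) := rfl

/-- The entries `(T_{α,W} a)_j = w_j · Φ_α(a_{j-1})`. -/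
def shiftSeq (α : X ≃ₜ X) (w : ℤ → X →ᵇ ℂ) (a : ℤ → C₀(X, ℂ)) (j : ℤ) : C₀(X, ℂ) :=
  bmul (w j) (compHomeo α (a (j - 1)))

@[simp] theorem shiftSeq_apply (α : X ≃ₜ X) (w : ℤ → X →ᵇ ℂ) (a : ℤ → C₀(X, ℂ)) (j : ℤ) (x : X) :
    shiftSeq α w a j x = w j x * a (j - 1) (α x) := rfl

theorem sum_shiftSeq_le (α : X ≃ₜ X) {w : ℤ → X →ᵇ ℂ} {M : ℝ} (hM : ∀ j, ‖w j‖ ≤ M)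
    (a : ℤ → C₀(X, ℂ)) (x : X) (t : Finset ℤ) :
    ∑ j ∈ t, ‖shiftSeq α w a j x‖ ^ 2
      ≤ M ^ 2 * ∑ j ∈ t.map (Equiv.subRight (1 : ℤ)).toEmbedding, ‖a j (α x)‖ ^ 2 := by
  rw [Finset.sum_map, Finset.mul_sum]
  refine Finset.sum_le_sum fun j _ => ?_
  rw [shiftSeq_apply, norm_mul, mul_pow]
  exact mul_le_mul_of_nonneg_right
    (pow_le_pow_left₀ (norm_nonneg _) (((w j).norm_coe_le_norm x).trans (hM j)) 2) (sq_nonneg _)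

theorem summable_shiftSeq (α : X ≃ₜ X) {w : ℤ → X →ᵇ ℂ} {M : ℝ} (hM : ∀ j, ‖w j‖ ≤ M)
    (a : EllTwo X) :
    Summable fun j => star (shiftSeq α w a.coord j) * shiftSeq α w a.coord j := by
  have hs := (Equiv.subRight (1 : ℤ)).summable_iff.2 a.summable
  refine summable_of_norm_sum_le (C := M ^ 2 + 1) (by positivity) hs hs fun t => ?_
  refine norm_le_of_forall (by positivity) fun x => ?_
  rw [norm_sum_star_mul_self_apply]
  have h₁ := norm_apply_le (∑ j ∈ t.map (Equiv.subRight (1 : ℤ)).toEmbedding,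
    star (a.coord j) * a.coord j) (α x)
  rw [norm_sum_star_mul_self_apply, Finset.sum_map] at h₁
  have h₂ := sum_shiftSeq_le α hM a.coord x t
  rw [Finset.sum_map] at h₂
  rw [Finset.sum_map] at h₁
  refine h₂.trans ((mul_le_mul_of_nonneg_left h₁ (sq_nonneg M)).trans ?_)
  refine mul_le_mul (by linarith) ?_ (norm_nonneg _) (by positivity)
  exact le_add_of_nonneg_right (norm_nonneg _)

/-- The bounded operator `T_{α,W}` on `ℓ²(C₀(X))`, for a bounded sequence `W = (w_j)` in `C_b(X)`:
`(T_{α,W} a)_j = w_j · (a_{j-1} ∘ α)`. -/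
def weightedShift (α : X ≃ₜ X) (w : ℤ → X →ᵇ ℂ) (hw : BddAbove (Set.range fun j => ‖w j‖)) :
    EllTwo X →L[ℂ] EllTwo X :=
  LinearMap.mkContinuous
    { toFun := fun a => EllTwo.mk (shiftSeq α w a.coord)
        (summable_shiftSeq α (fun j => le_ciSup hw j) a)
      map_add' := fun a b => by
        ext j x
        simp [mul_add]
      map_smul' := fun c a => by
        ext j x
        simp
        ring }
    (⨆ j, ‖w j‖) fun a => by
      have hM : ∀ j, ‖w j‖ ≤ ⨆ j, ‖w j‖ := fun j => le_ciSup hw j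
      have hM₀ : 0 ≤ ⨆ j, ‖w j‖ := (norm_nonneg _).trans (hM 0)
      refine EllTwo.norm_le (mul_nonneg hM₀ (norm_nonneg a)) fun x t => ?_
      refine (sum_shiftSeq_le α hM a.coord x t).trans ?_
      rw [mul_pow]
      exact mul_le_mul_of_nonneg_left (a.sum_sq_le _ _) (sq_nonneg _)

@[simp] theorem weightedShift_coord_apply (α : X ≃ₜ X) (w : ℤ → X →ᵇ ℂ)
    (hw : BddAbove (Set.range fun j => ‖w j‖)) (a : EllTwo X) (j : ℤ) (x : X) :
    (weightedShift α w hw a).coord j x = w j x * a.coord (j - 1) (α x) := rfl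

/-! ### Hypercyclicity and the condition on the weights -/

/-- A bounded operator is hypercyclic if some orbit `{T^n x : n ≥ 0}` is dense. -/
def IsHypercyclic {E : Type*} [NormedAddCommGroup E] [NormedSpace ℂ E] (T : E →L[ℂ] E) : Prop :=
  ∃ x : E, Dense (Set.range fun n : ℕ => (T ^ n) x)

/-- For every non-empty compact `K ⊆ X` and every non-empty finite set `I` of positive integers
there are positive integers `r_0 < r_1 < ⋯` such that, for all `j ∈ I`, both
`sup_{t ∈ K} ∏_{i=1}^{r_k} |w_{i+j}(α^{-i} t)|` and
`sup_{t ∈ K} ∏_{i=1}^{r_k} |w_{j+1-i}(α^{i-1} t)|⁻¹` tend to `0` as `k → ∞`.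
Suprema are taken in `[0, ∞]`, where the reciprocal of `0` is `∞`; in particular the second limit
is `0` only if the reciprocals that occur in it are finite for all large `k`. -/
def WeightCondition (α : X ≃ₜ X) (w : ℤ → X →ᵇ ℂ) : Prop :=
  ∀ K : Set X, K.Nonempty → IsCompact K →
    ∀ I : Finset ℕ, I.Nonempty → (∀ j ∈ I, 0 < j) →
      ∃ r : ℕ → ℕ, StrictMono r ∧ (∀ k, 0 < r k) ∧
        ∀ j ∈ I,
          Filter.Tendsto
            (fun k => ⨆ t ∈ K, ∏ i ∈ Finset.Icc 1 (r k),
              ‖w ((i : ℤ) + (j : ℤ)) (α.symm^[i] t)‖ₑ)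
            Filter.atTop (nhds 0) ∧
          Filter.Tendsto
            (fun k => ⨆ t ∈ K, ∏ i ∈ Finset.Icc 1 (r k),
              (‖w ((j : ℤ) + 1 - (i : ℤ)) (α^[i - 1] t)‖ₑ)⁻¹)
            Filter.atTop (nhds 0)

end HilbertShift

end

noncomputable section

namespace HilbertShift

open Filter Topology

variable {X : Type*} [TopologicalSpace X]

/-! ### Products of weights along orbits -/

/-! Write `T` for the shift. Entry `j + n` of `T ^ n a` at `α^{-n} t` is the forward product times
`a_j(t)`, and entry `j` at `t` is the backward product times `a_{j-n}(α^n t)`. Both implications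
come from these two formulas.

Necessity: let `v` have a cut-off, equal to 1 on `K`, at the indices in `I` and zero elsewhere. A
dense orbit gives arbitrarily large `n` and some `b` with both `b` and `T ^ n b` close to `v`
(`frequently_approx_of_dense_orbit`). For large `n` the indices `j ± n` leave `I`, where `v` is
zero. The first formula then says that the forward product times a number near 1 is near 0, the
second that the backward product times a number near 0 is near 1.

Sufficiency: by Birkhoff's theorem (`isHypercyclic_of_transitive`) and density of `compactSpan`, it
is enough to find, for `u`, `v` in that span, exponents `r k` with `T ^ r k u → 0` and `y k → 0`
with `T ^ r k (y k) = v`; then `u + y k → u` is mapped to a sequence tending to `v`. The weight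
condition gives this only for elements supported at positive indices
(`WeightCondition.exists_tendsto`). A fixed power of `T` moves `u` and `v` there; it commutes with
`T ^ r k` and is bounded below, so the two limits can be pulled back. -/

/-- The product `∏_{i=1}^n w_{i+j}(α^{-i} t)`. -/
def forwardWeight (α : X ≃ₜ X) (w : ℤ → X →ᵇ ℂ) (j : ℤ) (n : ℕ) (t : X) : ℂ :=
  ∏ i ∈ Finset.Icc 1 n, w ((i : ℤ) + j) (α.symm^[i] t)

/-- The product `∏_{i=1}^n w_{j+1-i}(α^{i-1} t)`. -/
def backwardWeight (α : X ≃ₜ X) (w : ℤ → X →ᵇ ℂ) (j : ℤ) (n : ℕ) (t : X) : ℂ :=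
  ∏ i ∈ Finset.Icc 1 n, w (j + 1 - (i : ℤ)) (α^[i - 1] t)

theorem enorm_finsetProd {ι : Type*} (s : Finset ι) (f : ι → ℂ) :
    ∏ i ∈ s, ‖f i‖ₑ = ‖∏ i ∈ s, f i‖ₑ := by
  classical
  induction s using Finset.induction_on with
  | empty => simp
  | insert i s hi ih => rw [Finset.prod_insert hi, Finset.prod_insert hi, enorm_mul, ih]

/-- Non-vanishing is essential: the inverse of 0 is `⊤` in `[0, ∞]` but 0 in `ℂ`. -/
theorem prod_inv_enorm {ι : Type*} {s : Finset ι} {f : ι → ℂ} (h : ∏ i ∈ s, f i ≠ 0) :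
    ∏ i ∈ s, ‖f i‖ₑ⁻¹ = ‖(∏ i ∈ s, f i)⁻¹‖ₑ := by
  rw [← Finset.prod_inv_distrib, ← enorm_finsetProd]
  exact Finset.prod_congr rfl fun i hi => (enorm_inv (Finset.prod_ne_zero_iff.1 h i hi)).symm

theorem enorm_le_ofReal_iff {z : ℂ} {ε : ℝ} (hε : 0 ≤ ε) :
    ‖z‖ₑ ≤ ENNReal.ofReal ε ↔ ‖z‖ ≤ ε := by
  rw [← ofReal_norm, ENNReal.ofReal_le_ofReal_iff hε]

theorem tendsto_biSup_nhds_zero_iff {Y ι : Type*} {l : Filter ι} {K : Set Y}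
    {F : ι → Y → ENNReal} :
    Tendsto (fun k => ⨆ t ∈ K, F k t) l (𝓝 0) ↔
      ∀ ε : ℝ, 0 < ε → ∀ᶠ k in l, ∀ t ∈ K, F k t ≤ ENNReal.ofReal ε := by
  simp_rw [ENNReal.tendsto_nhds_zero, iSup₂_le_iff]
  refine ⟨fun h ε hε => h _ (ENNReal.ofReal_pos.2 hε), fun h ε hε => ?_⟩
  rcases eq_or_ne ε ⊤ with rfl | hε'
  · simp
  · simpa [ENNReal.ofReal_toReal hε'] using h ε.toReal (ENNReal.toReal_pos hε.ne' hε')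

theorem pow_weightedShift_coord_forward (α : X ≃ₜ X) (w : ℤ → X →ᵇ ℂ)
    (hw : BddAbove (Set.range fun j => ‖w j‖)) (n : ℕ) (a : EllTwo X) (j : ℤ) (t : X) :
    ((weightedShift α w hw ^ n) a).coord (j + n) (α.symm^[n] t)
      = forwardWeight α w j n t * a.coord j t := by
  induction n with
  | zero => simp [forwardWeight]
  | succ n ih =>
    have h₁ : j + ((n + 1 : ℕ) : ℤ) - 1 = j + n := by push_cast; ring
    have h₂ : α (α.symm^[n + 1] t) = α.symm^[n] t := by
      rw [Function.iterate_succ_apply', α.apply_symm_apply]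
    rw [pow_succ', mul_apply_eq_comp, weightedShift_coord_apply, h₁, h₂, ih,
      forwardWeight, forwardWeight, Finset.prod_Icc_succ_top (by lia), add_comm j]
    ring

theorem pow_weightedShift_coord_backward (α : X ≃ₜ X) (w : ℤ → X →ᵇ ℂ)
    (hw : BddAbove (Set.range fun j => ‖w j‖)) (n : ℕ) (a : EllTwo X) (j : ℤ) (t : X) :
    ((weightedShift α w hw ^ n) a).coord j t
      = backwardWeight α w j n t * a.coord (j - n) (α^[n] t) := by
  induction n generalizing a with
  | zero => simp [backwardWeight]
  -- Here the innermost factor of the power is peeled off, hence the induction over all `a`; the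
  -- forward formula peels off the outermost.
  | succ n ih =>
    have h₁ : j - (n : ℤ) - 1 = j - ((n + 1 : ℕ) : ℤ) := by push_cast; ring
    have h₂ : j + 1 - ((n + 1 : ℕ) : ℤ) = j - n := by push_cast; ring
    rw [pow_succ, mul_apply_eq_comp, ih, weightedShift_coord_apply, h₁,
      backwardWeight, backwardWeight, Finset.prod_Icc_succ_top (by lia), h₂,
      Nat.add_sub_cancel, Function.iterate_succ_apply']
    ring

/-! ### Elements with a single entry -/

theorem star_mul_self_single_eq_zero (j : ℤ) (f : C₀(X, ℂ)) {p : ℤ} (hp : p ∉ ({j} : Finset ℤ)) :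
    star ((Pi.single j f : ℤ → C₀(X, ℂ)) p) * (Pi.single j f : ℤ → C₀(X, ℂ)) p = 0 := by
  rw [Finset.mem_singleton] at hp
  simp [Pi.single_eq_of_ne hp]

/-- The element of `ℓ²(C₀(X))` with `j`-th entry `f` and all other entries zero. -/
def EllTwo.single (j : ℤ) (f : C₀(X, ℂ)) : EllTwo X :=
  EllTwo.mk (Pi.single j f)
    (summable_of_ne_finset_zero (s := {j}) fun _ hp => star_mul_self_single_eq_zero j f hp)

theorem EllTwo.coord_single_self (j : ℤ) (f : C₀(X, ℂ)) : (EllTwo.single j f).coord j = f := by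
  simp [EllTwo.single]

theorem EllTwo.coord_single_of_ne {j p : ℤ} (h : p ≠ j) (f : C₀(X, ℂ)) :
    (EllTwo.single j f).coord p = 0 := by
  simp [EllTwo.single, Pi.single_eq_of_ne h]

theorem EllTwo.norm_le_of_coord_eq_zero {a : EllTwo X} {j : ℤ} {C : ℝ} (hC : 0 ≤ C)
    (h₀ : ∀ p ≠ j, ∀ x, a.coord p x = 0) (h : ∀ x, ‖a.coord j x‖ ≤ C) : ‖a‖ ≤ C := by
  refine EllTwo.norm_le hC fun x t => ?_
  calc ∑ p ∈ t, ‖a.coord p x‖ ^ 2 ≤ ∑ p ∈ insert j t, ‖a.coord p x‖ ^ 2 :=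
        Finset.sum_le_sum_of_subset_of_nonneg (Finset.subset_insert _ _)
          fun _ _ _ => sq_nonneg _
    _ = ‖a.coord j x‖ ^ 2 :=
        Finset.sum_eq_single j (fun p _ hp => by simp [h₀ p hp x]) (by simp)
    _ ≤ C ^ 2 := pow_le_pow_left₀ (norm_nonneg _) (h x) 2

theorem EllTwo.norm_single_le (j : ℤ) (f : C₀(X, ℂ)) : ‖EllTwo.single j f‖ ≤ ‖f‖ :=
  EllTwo.norm_le_of_coord_eq_zero (norm_nonneg f)
    (fun p hp x => by rw [EllTwo.coord_single_of_ne hp]; rfl)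
    fun x => by rw [EllTwo.coord_single_self]; exact norm_apply_le f x

/-! ### Cut-off functions -/

/-- The bound is on `1 - χ` because the later approximation estimates `χ * f - f`. -/
theorem exists_cutoff [LocallyCompactSpace X] [T2Space X] {K : Set X} (hK : IsCompact K) :
    ∃ χ : C₀(X, ℂ), HasCompactSupport χ ∧ (∀ x ∈ K, χ x = 1) ∧
      (∀ x, ‖1 - χ x‖ ≤ 1) := by
  obtain ⟨f, h₁, -, hc, h⟩ := exists_continuous_one_zero_of_isCompact hK isClosed_empty
    (Set.disjoint_empty K)
  have hc' : HasCompactSupport fun x => (f x : ℂ) :=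
    hc.comp_left (g := fun r : ℝ => (r : ℂ)) Complex.ofReal_zero
  have hcont : Continuous fun x => (f x : ℂ) := Complex.continuous_ofReal.comp f.continuous
  refine ⟨⟨⟨fun x => (f x : ℂ), hcont⟩, hc'.is_zero_at_infty⟩, hc', fun x hx => ?_, fun x => ?_⟩
  · change (f x : ℂ) = 1
    rw [h₁ hx]
    simp
  · change ‖1 - (f x : ℂ)‖ ≤ 1
    rw [← Complex.ofReal_one, ← Complex.ofReal_sub, Complex.norm_real, Real.norm_eq_abs, abs_le]
    have := h x
    constructor <;> linarith [this.1, this.2]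

/-! ### Hypercyclic shifts satisfy the weight condition -/

/-- A nontrivial normed space has no isolated points, so the orbit stays dense after its first `N`
terms are removed and returns near `v` at arbitrarily late times. Two such times `m ≤ n` give `b = T
^ m a` and the exponent `n - m`. -/
theorem frequently_approx_of_dense_orbit {E : Type*} [NormedAddCommGroup E] [NormedSpace ℂ E]
    [Nontrivial E] {T : E →L[ℂ] E} {a : E} (ha : Dense (Set.range fun n : ℕ => (T ^ n) a))
    (v : E) {ε : ℝ} (hε : 0 < ε) :
    ∃ᶠ n in atTop, ∃ b : E, ‖b - v‖ < ε ∧ ‖(T ^ n) b - v‖ < ε := by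
  have key : ∀ N : ℕ, ∃ n ≥ N, ‖(T ^ n) a - v‖ < ε := fun N => by
    have : ∀ x : E, NeBot (𝓝[≠] x) := fun x => Module.punctured_nhds_neBot ℂ E x
    have hd := ha.sdiff_finite ((Finset.range N).finite_toSet.image fun n : ℕ => (T ^ n) a)
    obtain ⟨y, ⟨⟨n, rfl⟩, hn⟩, hy⟩ := hd.exists_dist_lt v hε
    refine ⟨n, ?_, by rwa [dist_comm, dist_eq_norm] at hy⟩
    by_contra! hlt
    exact hn ⟨n, by simpa using hlt, rfl⟩
  refine frequently_atTop.2 fun N => ?_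
  obtain ⟨m, -, hm⟩ := key 0
  obtain ⟨n, hn, hn'⟩ := key (N + m)
  refine ⟨n - m, by lia, (T ^ m) a, hm, ?_⟩
  rwa [← mul_apply_eq_comp, ← pow_add, Nat.sub_add_cancel (by lia)]

theorem IsHypercyclic.weightCondition [LocallyCompactSpace X] [T2Space X] {α : X ≃ₜ X}
    {w : ℤ → X →ᵇ ℂ} {hw : BddAbove (Set.range fun j => ‖w j‖)}
    (h : IsHypercyclic (weightedShift α w hw)) : WeightCondition α w := by
  classical
  intro K hKne hK I hI _
  obtain ⟨a, ha⟩ := h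
  obtain ⟨χ, -, hχ, -⟩ := exists_cutoff hK
  have hmem : ∀ p : ℤ, p ∉ I.image (fun j : ℕ => (j : ℤ)) →
      (if p ∈ I.image (fun j : ℕ => (j : ℤ)) then χ else 0) = 0 := fun p hp => if_neg hp
  set v : EllTwo X := EllTwo.mk (fun p => if p ∈ I.image (fun j : ℕ => (j : ℤ)) then χ else 0)
    (summable_of_ne_finset_zero (s := I.image (fun j : ℕ => (j : ℤ)))
      fun p hp => by rw [hmem p hp, mul_zero]) with hv
  have hv₀ : ∀ p : ℤ, p ∉ I.image (fun j : ℕ => (j : ℤ)) → ∀ x, v.coord p x = 0 :=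
    fun p hp x => by rw [hv, EllTwo.coord_mk, hmem p hp]; rfl
  have hv₁ : ∀ j ∈ I, ∀ x ∈ K, v.coord (j : ℤ) x = 1 := fun j hj x hx => by
    rw [hv, EllTwo.coord_mk, if_pos (Finset.mem_image_of_mem _ hj), hχ x hx]
  have : Nontrivial (EllTwo X) := by
    obtain ⟨x, hx⟩ := hKne
    obtain ⟨j, hj⟩ := hI
    refine ⟨v, 0, fun h => ?_⟩
    have := hv₁ j hj x hx
    simp [h] at this
  obtain ⟨M, hM⟩ : ∃ M : ℕ, ∀ j ∈ I, j ≤ M := ⟨I.sup id, fun j hj => Finset.le_sup (f := id) hj⟩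
  have main : ∀ k : ℕ, ∃ᶠ n in atTop, 0 < n ∧ ∀ j ∈ I, ∀ t ∈ K,
      ‖forwardWeight α w j n t‖ ≤ 1 / ((k : ℝ) + 1) ∧ backwardWeight α w j n t ≠ 0 ∧
      ‖(backwardWeight α w j n t)⁻¹‖ ≤ 1 / ((k : ℝ) + 1) := fun k => by
    have hk : (0 : ℝ) < k + 1 := by positivity
    -- With `ε = 1 / (k + 2)`, a number within `ε` of 1 has modulus at least `1 - ε`, and `ε / (1 -
    -- ε) = 1 / (k + 1)`.
    have hε : (0 : ℝ) < 1 / (k + 2) := by positivity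
    refine ((frequently_approx_of_dense_orbit ha v hε).and_eventually
      (eventually_gt_atTop M)).mono ?_
    rintro n ⟨⟨b, hb, hTb⟩, hn⟩
    refine ⟨by lia, fun j hj t ht => ?_⟩
    have near : ∀ {c : EllTwo X}, ‖c - v‖ < 1 / ((k : ℝ) + 2) → ∀ p x,
        ‖c.coord p x - v.coord p x‖ < 1 / ((k : ℝ) + 2) := fun {c} hc p x => by
      refine lt_of_le_of_lt ?_ hc
      have := EllTwo.norm_coord_apply_le (c - v) p x
      rwa [sub_eq_add_neg, EllTwo.coord_add, EllTwo.coord_neg, ZeroAtInftyContinuousMap.add_apply,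
        ZeroAtInftyContinuousMap.neg_apply, ← sub_eq_add_neg, ← sub_eq_add_neg] at this
    have large : ∀ {z : ℂ}, ‖z - 1‖ < 1 / ((k : ℝ) + 2) → ((k : ℝ) + 1) / (k + 2) ≤ ‖z‖ :=
      fun {z} hz => by
        have h₁ := norm_sub_norm_le (1 : ℂ) z
        rw [norm_sub_rev, norm_one] at h₁
        have h₂ : ((k : ℝ) + 1) / (k + 2) = 1 - 1 / (k + 2) := by field_simp; ring
        linarith
    have hjM := hM j hj
    have out₁ : (j : ℤ) + n ∉ I.image (fun j : ℕ => (j : ℤ)) := fun hmem => by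
      obtain ⟨i, hi, hij⟩ := Finset.mem_image.1 hmem
      have := hM i hi
      lia
    -- Since `j ≤ M < n`, this index is negative, while `I` consists of natural numbers.
    have out₂ : (j : ℤ) - n ∉ I.image (fun j : ℕ => (j : ℤ)) := fun hmem => by
      obtain ⟨i, hi, hij⟩ := Finset.mem_image.1 hmem
      lia
    have hf₁ := near hb j t
    rw [hv₁ j hj t ht] at hf₁
    have hf₂ := near hTb (j + n) (α.symm^[n] t)
    rw [hv₀ _ out₁, sub_zero, pow_weightedShift_coord_forward, norm_mul] at hf₂
    have hb₁ := near hTb j t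
    rw [hv₁ j hj t ht, pow_weightedShift_coord_backward] at hb₁
    have hb₂ := near hb (j - n) (α^[n] t)
    rw [hv₀ _ out₂, sub_zero] at hb₂
    have hf₃ := large hf₁
    have hb₃ := large hb₁
    rw [norm_mul] at hb₃
    have hε' : ((k : ℝ) + 1) / (k + 2) = (k + 1) * (1 / (k + 2)) := by ring
    rw [hε'] at hf₃ hb₃
    have hne : backwardWeight α w j n t ≠ 0 := fun h0 => by
      rw [h0, norm_zero, zero_mul] at hb₃
      exact absurd hb₃ (not_le.2 (by positivity))
    refine ⟨?_, hne, ?_⟩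
    · rw [le_div_iff₀ hk]
      by_contra! hlt
      have := mul_le_mul_of_nonneg_left hf₃ (norm_nonneg (forwardWeight α w j n t))
      nlinarith
    · rw [norm_inv, inv_eq_one_div]
      refine one_div_le_one_div_of_le hk ?_
      by_contra! hlt
      have h₁ : 0 < ‖backwardWeight α w j n t‖ := norm_pos_iff.2 hne
      have := mul_le_mul_of_nonneg_left hb₂.le h₁.le
      nlinarith
  -- Each tolerance `1 / (k + 1)` is met for arbitrarily large `n`, so the exponents can be chosen
  -- strictly increasing.
  obtain ⟨r, hr, hr'⟩ := extraction_forall_of_frequently main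
  have small : ∀ ε : ℝ, 0 < ε → ∀ᶠ k : ℕ in atTop, 1 / ((k : ℝ) + 1) ≤ ε := fun ε hε =>
    (tendsto_one_div_add_atTop_nhds_zero_nat.eventually (gt_mem_nhds hε)).mono fun _ h => h.le
  refine ⟨r, hr, fun k => (hr' k).1, fun j hj => ⟨?_, ?_⟩⟩
  · refine tendsto_biSup_nhds_zero_iff.2 fun ε hε => (small ε hε).mono fun k hk t ht => ?_
    rw [enorm_finsetProd, enorm_le_ofReal_iff hε.le]
    exact ((hr' k).2 j hj t ht).1.trans hk
  · refine tendsto_biSup_nhds_zero_iff.2 fun ε hε => (small ε hε).mono fun k hk t ht => ?_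
    have := (hr' k).2 j hj t ht
    rw [prod_inv_enorm this.2.1, enorm_le_ofReal_iff hε.le]
    exact this.2.2.trans hk

/-! ### Completeness of `ℓ²(C₀(X))` -/

theorem EllTwo.coord_sub_apply (a b : EllTwo X) (j : ℤ) (x : X) :
    (a - b).coord j x = a.coord j x - b.coord j x := by
  rw [sub_eq_add_neg, EllTwo.coord_add, EllTwo.coord_neg, ZeroAtInftyContinuousMap.add_apply,
    ZeroAtInftyContinuousMap.neg_apply, ← sub_eq_add_neg]

/-- Needed for Baire's theorem. Entries converge uniformly; the Cauchy estimate, being about finite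
sums at a point, survives the limit in the second index. -/
instance EllTwo.instCompleteSpace : CompleteSpace (EllTwo X) := by
  refine Metric.complete_of_cauchySeq_tendsto fun u hu => ?_
  have hcoord : ∀ j, ∃ f : C₀(X, ℂ), Tendsto (fun n => (u n).coord j) atTop (𝓝 f) := fun j => by
    refine cauchySeq_tendsto_of_complete (Metric.cauchySeq_iff.2 fun ε hε => ?_)
    obtain ⟨N, hN⟩ := Metric.cauchySeq_iff.1 hu ε hε
    refine ⟨N, fun m hm n hn => lt_of_le_of_lt ?_ (hN m hm n hn)⟩
    rw [dist_eq_norm, dist_eq_norm]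
    exact norm_le_of_forall (norm_nonneg _) fun x => by
      have := (u m - u n).norm_coord_apply_le j x
      rwa [EllTwo.coord_sub_apply] at this
  choose a ha using hcoord
  have ha' : ∀ j x, Tendsto (fun n => (u n).coord j x) atTop (𝓝 (a j x)) := fun j x =>
    (ZeroAtInftyContinuousMap.tendsto_iff_tendstoUniformly.1 (ha j)).tendsto_at x
  have unif : ∀ ε : ℝ, 0 < ε → ∃ N, ∀ n ≥ N, ∀ (x : X) (t : Finset ℤ),
      ∑ j ∈ t, ‖(u n).coord j x - a j x‖ ^ 2 ≤ ε ^ 2 := fun ε hε => by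
    obtain ⟨N, hN⟩ := Metric.cauchySeq_iff.1 hu ε hε
    refine ⟨N, fun n hn x t => ?_⟩
    refine le_of_tendsto (tendsto_finsetSum t fun j _ =>
      (((ha' j x).const_sub ((u n).coord j x)).norm.pow 2)) ?_
    filter_upwards [eventually_ge_atTop N] with m hm
    have h := hN n hn m hm
    rw [dist_eq_norm] at h
    have h' := (u n - u m).sum_sq_le x t
    simp_rw [EllTwo.coord_sub_apply] at h'
    exact h'.trans (pow_le_pow_left₀ (norm_nonneg _) h.le 2)
  have hsum : Summable fun j => star (a j) * a j := by
    rw [summable_iff_vanishing_norm]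
    intro ε hε
    -- From `|a|² ≤ 2|u|² + 2|u - a|²` the two errors `ε / 8` add up to `ε / 2`, leaving room for
    -- the strict inequality after the supremum over `x`.
    obtain ⟨N, hN⟩ := unif (√(ε / 8)) (by positivity)
    rw [Real.sq_sqrt (by positivity)] at hN
    obtain ⟨s, hs⟩ := summable_iff_vanishing_norm.1 (u N).summable (ε / 8) (by positivity)
    refine ⟨s, fun t ht => ?_⟩
    refine lt_of_le_of_lt (norm_le_of_forall (C := ε / 2) (by positivity) fun x => ?_) (by linarith)
    have h₁ := (norm_apply_le _ x).trans (hs t ht).le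
    rw [norm_sum_star_mul_self_apply] at h₁ ⊢
    have h₂ := hN N le_rfl x t
    calc ∑ j ∈ t, ‖a j x‖ ^ 2
        ≤ ∑ j ∈ t, (2 * ‖(u N).coord j x‖ ^ 2 + 2 * ‖(u N).coord j x - a j x‖ ^ 2) := by
          refine Finset.sum_le_sum fun j _ => ?_
          have h := norm_sub_le ((u N).coord j x) ((u N).coord j x - a j x)
          rw [sub_sub_cancel] at h
          nlinarith [norm_nonneg (a j x),
            sq_nonneg (‖(u N).coord j x‖ - ‖(u N).coord j x - a j x‖)]
      _ = 2 * ∑ j ∈ t, ‖(u N).coord j x‖ ^ 2 + 2 * ∑ j ∈ t, ‖(u N).coord j x - a j x‖ ^ 2 := by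
          rw [Finset.sum_add_distrib, Finset.mul_sum, Finset.mul_sum]
      _ ≤ ε / 2 := by linarith
  refine ⟨EllTwo.mk a hsum, Metric.tendsto_atTop.2 fun ε hε => ?_⟩
  obtain ⟨N, hN⟩ := unif (ε / 2) (by positivity)
  refine ⟨N, fun n hn => ?_⟩
  rw [dist_eq_norm]
  refine lt_of_le_of_lt (EllTwo.norm_le (C := ε / 2) (by positivity) fun x t => ?_) (by linarith)
  simp_rw [EllTwo.coord_sub_apply, EllTwo.coord_mk]
  exact hN n hn x t

/-! ### Birkhoff's transitivity theorem -/

/-- The points whose orbit meets every member of a countable basis form a countable intersection of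
open sets, dense by transitivity; Baire's theorem provides one. -/
theorem isHypercyclic_of_transitive {E : Type*} [NormedAddCommGroup E] [NormedSpace ℂ E]
    [CompleteSpace E] [TopologicalSpace.SeparableSpace E] {T : E →L[ℂ] E}
    (hT : ∀ U V : Set E, IsOpen U → U.Nonempty → IsOpen V → V.Nonempty →
      ∃ n : ℕ, ∃ u ∈ U, (T ^ n) u ∈ V) : IsHypercyclic T := by
  have : SecondCountableTopology E := UniformSpace.secondCountable_of_separable E
  let B := TopologicalSpace.countableBasis E
  have hB := TopologicalSpace.isBasis_countableBasis E
  have : Countable B := (TopologicalSpace.countable_countableBasis E).to_subtype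
  have hd : Dense (⋂ V : B, ⋃ n : ℕ, (T ^ n) ⁻¹' (V : Set E)) := by
    refine dense_iInter_of_isOpen (fun V => isOpen_iUnion fun n =>
      (hB.isOpen V.2).preimage (T ^ n).continuous) fun V => ?_
    refine dense_iff_inter_open.2 fun U hU hne => ?_
    obtain ⟨n, u, hu, hn⟩ := hT U V hU hne (hB.isOpen V.2)
      (TopologicalSpace.nonempty_of_mem_countableBasis V.2)
    exact ⟨u, hu, Set.mem_iUnion.2 ⟨n, hn⟩⟩
  obtain ⟨x, hx⟩ := hd.nonempty
  refine ⟨x, hB.dense_iff.2 fun V hV _ => ?_⟩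
  obtain ⟨n, hn⟩ := Set.mem_iUnion.1 (Set.mem_iInter.1 hx ⟨V, hV⟩)
  exact ⟨(T ^ n) x, hn, n, rfl⟩

/-! ### Finitely supported elements with compactly supported entries -/

variable (X) in
/-- The span of the elements whose only non-zero entry has its index in `[p, q]` and vanishes
off `K`. -/
def boxSpan (p q : ℤ) (K : Set X) : Submodule ℂ (EllTwo X) :=
  Submodule.span ℂ {a | ∃ j f, p ≤ j ∧ j ≤ q ∧ (∀ x ∉ K, f x = 0) ∧ a = EllTwo.single j f}

theorem boxSpan_mono {p p' q q' : ℤ} {K K' : Set X} (hp : p' ≤ p) (hq : q ≤ q') (hK : K ⊆ K') :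
    boxSpan X p q K ≤ boxSpan X p' q' K' := by
  refine Submodule.span_mono ?_
  rintro _ ⟨j, f, h₁, h₂, h₃, rfl⟩
  exact ⟨j, f, hp.trans h₁, h₂.trans hq, fun x hx => h₃ x fun h => hx (hK h), rfl⟩

theorem EllTwo.coord_sum {ι : Type*} (s : Finset ι) (b : ι → EllTwo X) (p : ℤ) :
    (∑ i ∈ s, b i).coord p = ∑ i ∈ s, (b i).coord p := by
  classical
  induction s using Finset.induction_on with
  | empty => simp
  | insert i s hi ih => rw [Finset.sum_insert hi, Finset.sum_insert hi, EllTwo.coord_add, ih]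

theorem EllTwo.coord_sum_single (a : EllTwo X) (s : Finset ℤ) (p : ℤ) :
    (∑ j ∈ s, EllTwo.single j (a.coord j)).coord p = if p ∈ s then a.coord p else 0 := by
  rw [EllTwo.coord_sum]
  split_ifs with h
  · rw [Finset.sum_eq_single p (fun j _ hj => EllTwo.coord_single_of_ne hj.symm _)
      (fun h' => absurd h h'), EllTwo.coord_single_self]
  · exact Finset.sum_eq_zero fun j hj => EllTwo.coord_single_of_ne (by rintro rfl; exact h hj) _

/-- The squared norm of a remainder is controlled by tails of the norm-convergent series `∑ a_j^*
a_j`. -/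
theorem EllTwo.hasSum_single (a : EllTwo X) :
    HasSum (fun j => EllTwo.single j (a.coord j)) a := by
  classical
  refine Metric.tendsto_atTop.2 fun ε hε => ?_
  obtain ⟨s, hs⟩ := summable_iff_vanishing_norm.1 a.summable ((ε / 2) ^ 2) (by positivity)
  refine ⟨s, fun t hst => ?_⟩
  rw [dist_eq_norm]
  refine lt_of_le_of_lt (EllTwo.norm_le (C := ε / 2) (by positivity) fun x r => ?_) (by linarith)
  have hr := (norm_apply_le _ x).trans
    (hs (r \ t) (Finset.disjoint_of_subset_right hst Finset.sdiff_disjoint)).le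
  rw [norm_sum_star_mul_self_apply] at hr
  refine le_trans (le_of_eq ?_) hr
  rw [Finset.sdiff_eq_filter, Finset.sum_filter]
  refine Finset.sum_congr rfl fun j _ => ?_
  rw [EllTwo.coord_sub_apply, EllTwo.coord_sum_single]
  by_cases hj : j ∈ t <;> simp [hj]

theorem exists_norm_sub_lt_of_hasCompactSupport [LocallyCompactSpace X] [T2Space X]
    (f : C₀(X, ℂ)) {ε : ℝ} (hε : 0 < ε) :
    ∃ g : C₀(X, ℂ), HasCompactSupport g ∧ ‖g - f‖ < ε := by
  have h := (ZeroAtInftyContinuousMapClass.zero_at_infty f).norm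
  rw [norm_zero] at h
  obtain ⟨K, hK, hKf⟩ := mem_cocompact.1 (h (Iio_mem_nhds (half_pos hε)))
  obtain ⟨χ, hχ, hχ₁, hχ₂⟩ := exists_cutoff hK
  refine ⟨χ * f, hχ.mul_right, ?_⟩
  refine lt_of_le_of_lt (norm_le_of_forall (half_pos hε).le fun x => ?_) (half_lt_self hε)
  have hx : (χ * f - f) x = -((1 - χ x) * f x) := by
    simp only [ZeroAtInftyContinuousMap.sub_apply, ZeroAtInftyContinuousMap.mul_apply]
    ring
  rw [hx, norm_neg, norm_mul]
  by_cases hxK : x ∈ K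
  · rw [hχ₁ x hxK, sub_self, norm_zero, zero_mul]
    exact (half_pos hε).le
  · have : ‖f x‖ < ε / 2 := hKf hxK
    nlinarith [hχ₂ x, norm_nonneg (f x), norm_nonneg (1 - χ x)]

variable (X) in
/-- The finitely supported elements with compactly supported entries. -/
def compactSpan : Submodule ℂ (EllTwo X) :=
  Submodule.span ℂ {a | ∃ j, ∃ f : C₀(X, ℂ), HasCompactSupport f ∧ a = EllTwo.single j f}

theorem EllTwo.single_sub (j : ℤ) (f g : C₀(X, ℂ)) :
    EllTwo.single j f - EllTwo.single j g = EllTwo.single j (f - g) := by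
  ext p x
  rw [EllTwo.coord_sub_apply]
  rcases eq_or_ne p j with rfl | h
  · simp [EllTwo.coord_single_self]
  · simp [EllTwo.coord_single_of_ne h]

theorem dense_compactSpan [LocallyCompactSpace X] [T2Space X] :
    Dense (compactSpan X : Set (EllTwo X)) := by
  intro a
  rw [← Submodule.topologicalClosure_coe]
  refine (Submodule.isClosed_topologicalClosure _).mem_of_tendsto a.hasSum_single
    (Eventually.of_forall fun s => Submodule.sum_mem _ fun j _ => ?_)
  rw [← SetLike.mem_coe, Submodule.topologicalClosure_coe, Metric.mem_closure_iff]
  intro ε hε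
  obtain ⟨g, hg, hgf⟩ := exists_norm_sub_lt_of_hasCompactSupport (a.coord j) hε
  refine ⟨EllTwo.single j g, Submodule.subset_span ⟨j, g, hg, rfl⟩, ?_⟩
  rw [dist_comm, dist_eq_norm, EllTwo.single_sub]
  exact (EllTwo.norm_single_le _ _).trans_lt hgf

theorem exists_mem_boxSpan {a : EllTwo X} (ha : a ∈ compactSpan X) :
    ∃ (m : ℕ) (K : Set X), IsCompact K ∧ a ∈ boxSpan X (-m) m K := by
  induction ha using Submodule.span_induction with
  | mem a h =>
    obtain ⟨j, f, hf, rfl⟩ := h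
    exact ⟨j.natAbs, tsupport f, hf, Submodule.subset_span
      ⟨j, f, by lia, by lia, fun x hx => image_eq_zero_of_notMem_tsupport hx, rfl⟩⟩
  | zero => exact ⟨0, ∅, isCompact_empty, zero_mem _⟩
  | add a b _ _ iha ihb =>
    obtain ⟨m, K, hK, ha⟩ := iha
    obtain ⟨n, L, hL, hb⟩ := ihb
    exact ⟨max m n, K ∪ L, hK.union hL, add_mem
      (boxSpan_mono (by lia) (by lia) Set.subset_union_left ha)
      (boxSpan_mono (by lia) (by lia) Set.subset_union_right hb)⟩
  | smul c a _ iha =>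
    obtain ⟨m, K, hK, ha⟩ := iha
    exact ⟨m, K, hK, Submodule.smul_mem _ c ha⟩

/-! ### The action of the shift on single entries -/

section Shift

variable (α : X ≃ₜ X) (w : ℤ → X →ᵇ ℂ) (hw : BddAbove (Set.range fun j => ‖w j‖))

theorem weightedShift_single (j : ℤ) (f : C₀(X, ℂ)) :
    weightedShift α w hw (EllTwo.single j f)
      = EllTwo.single (j + 1) (bmul (w (j + 1)) (compHomeo α f)) := by
  ext p x
  rw [weightedShift_coord_apply]
  rcases eq_or_ne p (j + 1) with rfl | h
  · simp [EllTwo.coord_single_self]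
  · rw [EllTwo.coord_single_of_ne h, EllTwo.coord_single_of_ne (by lia)]
    simp

theorem exists_pow_weightedShift_mem_boxSpan (p q : ℤ) {K : Set X} (hK : IsCompact K) (n : ℕ) :
    ∃ L : Set X, IsCompact L ∧ ∀ a ∈ boxSpan X p q K,
      (weightedShift α w hw ^ n) a ∈ boxSpan X (p + n) (q + n) L := by
  induction n with
  | zero => exact ⟨K, hK, fun a ha => by simpa using ha⟩
  | succ n ih =>
    obtain ⟨L, hL, h⟩ := ih
    refine ⟨α ⁻¹' L, α.isCompact_preimage.2 hL, fun a ha => ?_⟩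
    rw [pow_succ', mul_apply_eq_comp]
    refine Submodule.span_induction (p := fun b _ => weightedShift α w hw b ∈
      boxSpan X (p + (n + 1 : ℕ)) (q + (n + 1 : ℕ)) (α ⁻¹' L)) ?_ ?_ ?_ ?_ (h a ha)
    · rintro _ ⟨j, f, h₁, h₂, h₃, rfl⟩
      rw [weightedShift_single]
      refine Submodule.subset_span ⟨j + 1, _, by push_cast; lia, by push_cast; lia,
        fun x hx => ?_, rfl⟩
      rw [bmul_apply, compHomeo_apply, h₃ _ hx, mul_zero]
    · rw [map_zero]
      exact zero_mem _
    · intro b c _ _ hb hc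
      rw [map_add]
      exact add_mem hb hc
    · intro c b _ hb
      rw [map_smul]
      exact Submodule.smul_mem _ c hb

variable {C : ℝ}

theorem norm_le_mul_norm_weightedShift
    (hC : ∀ j x, ‖(w j x)⁻¹‖ ≤ C) (hw₀ : ∀ j x, w j x ≠ 0) (hC₀ : 0 ≤ C) (a : EllTwo X) :
    ‖a‖ ≤ C * ‖weightedShift α w hw a‖ := by
  refine EllTwo.norm_le (by positivity) fun x t => ?_
  have h := (weightedShift α w hw a).sum_sq_le (α.symm x)
    (t.map (Equiv.addRight (1 : ℤ)).toEmbedding)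
  rw [Finset.sum_map] at h
  rw [mul_pow]
  refine le_trans ?_ (mul_le_mul_of_nonneg_left h (sq_nonneg C))
  rw [Finset.mul_sum]
  refine Finset.sum_le_sum fun j _ => ?_
  have hj : (Equiv.addRight (1 : ℤ)).toEmbedding j = j + 1 := rfl
  rw [hj, weightedShift_coord_apply, α.apply_symm_apply, add_sub_cancel_right, ← mul_pow]
  refine pow_le_pow_left₀ (norm_nonneg _) ?_ 2
  have h₁ := hC (j + 1) (α.symm x)
  have h₂ : ‖(w (j + 1) (α.symm x))⁻¹‖ * ‖w (j + 1) (α.symm x)‖ = 1 := by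
    rw [← norm_mul, inv_mul_cancel₀ (hw₀ _ _), norm_one]
  rw [norm_mul, ← mul_assoc]
  calc ‖a.coord j x‖ = 1 * ‖a.coord j x‖ := (one_mul _).symm
    _ ≤ _ := by rw [← h₂]; gcongr

theorem norm_le_mul_norm_pow_weightedShift
    (hC : ∀ j x, ‖(w j x)⁻¹‖ ≤ C) (hw₀ : ∀ j x, w j x ≠ 0) (hC₀ : 0 ≤ C) (n : ℕ)
    (a : EllTwo X) : ‖a‖ ≤ C ^ n * ‖(weightedShift α w hw ^ n) a‖ := by
  induction n generalizing a with
  | zero => simp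
  | succ n ih =>
    rw [pow_succ (weightedShift α w hw), mul_apply_eq_comp]
    calc ‖a‖ ≤ C * ‖weightedShift α w hw a‖ :=
          norm_le_mul_norm_weightedShift α w hw hC hw₀ hC₀ a
      _ ≤ C * (C ^ n * ‖(weightedShift α w hw ^ n) (weightedShift α w hw a)‖) := by
          gcongr; exact ih _
      _ = _ := by ring

/-- The reciprocal of `w j` is bounded and continuous, so dividing by it stays inside `C₀(X)`. -/
theorem exists_weightedShift_single_eq
    (hC : ∀ j x, ‖(w j x)⁻¹‖ ≤ C) (hw₀ : ∀ j x, w j x ≠ 0) (j : ℤ) (f : C₀(X, ℂ)) :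
    ∃ g, weightedShift α w hw (EllTwo.single (j - 1) g) = EllTwo.single j f := by
  let v : X →ᵇ ℂ := BoundedContinuousFunction.ofNormedAddCommGroup (fun x => (w j x)⁻¹)
    ((w j).continuous.inv₀ (hw₀ j)) C (hC j)
  refine ⟨compHomeo α.symm (bmul v f), ?_⟩
  rw [weightedShift_single, sub_add_cancel]
  congr 1
  ext x
  have : v x = (w j x)⁻¹ := rfl
  simp [this, hw₀ j x]

theorem exists_pow_weightedShift_single_eq
    (hC : ∀ j x, ‖(w j x)⁻¹‖ ≤ C) (hw₀ : ∀ j x, w j x ≠ 0) (n : ℕ) (j : ℤ)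
    (f : C₀(X, ℂ)) :
    ∃ g, (weightedShift α w hw ^ n) (EllTwo.single (j - n) g) = EllTwo.single j f := by
  induction n with
  | zero => exact ⟨f, by simp⟩
  | succ n ih =>
    obtain ⟨g, hg⟩ := ih
    obtain ⟨g', hg'⟩ := exists_weightedShift_single_eq α w hw hC hw₀ (j - n) g
    refine ⟨g', ?_⟩
    rw [pow_succ, mul_apply_eq_comp, show j - ((n + 1 : ℕ) : ℤ) = j - n - 1 by push_cast; ring,
      hg', hg]

theorem boxSpan_le_range_pow_weightedShift
    (hC : ∀ j x, ‖(w j x)⁻¹‖ ≤ C) (hw₀ : ∀ j x, w j x ≠ 0) (n : ℕ) (p q : ℤ)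
    (K : Set X) {a : EllTwo X} (ha : a ∈ boxSpan X p q K) :
    ∃ b, (weightedShift α w hw ^ n) b = a := by
  have : boxSpan X p q K ≤
      LinearMap.range ((weightedShift α w hw ^ n : EllTwo X →L[ℂ] EllTwo X) :
        EllTwo X →ₗ[ℂ] EllTwo X) := by
    refine Submodule.span_le.2 ?_
    rintro _ ⟨j, f, -, -, -, rfl⟩
    obtain ⟨g, hg⟩ := exists_pow_weightedShift_single_eq α w hw hC hw₀ n j f
    exact ⟨_, hg⟩
  exact this ha

end Shift

/-! ### The weight condition implies transitivity -/

theorem iterate_symm_iterate (α : X ≃ₜ X) (n : ℕ) (x : X) : α.symm^[n] (α^[n] x) = x :=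
  Function.LeftInverse.iterate α.symm_apply_apply n x

theorem iterate_iterate_symm (α : X ≃ₜ X) (n : ℕ) (x : X) : α^[n] (α.symm^[n] x) = x :=
  Function.LeftInverse.iterate α.apply_symm_apply n x

theorem norm_pow_weightedShift_single_le (α : X ≃ₜ X) (w : ℤ → X →ᵇ ℂ)
    (hw : BddAbove (Set.range fun j => ‖w j‖)) {K : Set X} {j : ℤ} {f : C₀(X, ℂ)}
    (hf : ∀ x ∉ K, f x = 0) {n : ℕ} {δ : ℝ} (hδ : 0 ≤ δ)
    (h : ∀ t ∈ K, ‖forwardWeight α w j n t‖ ≤ δ) :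
    ‖(weightedShift α w hw ^ n) (EllTwo.single j f)‖ ≤ δ * ‖f‖ := by
  refine EllTwo.norm_le_of_coord_eq_zero (j := j + n) (by positivity) (fun p hp x => ?_)
    fun x => ?_
  · have := pow_weightedShift_coord_forward α w hw n (EllTwo.single j f) (p - n) (α^[n] x)
    rw [iterate_symm_iterate, sub_add_cancel, EllTwo.coord_single_of_ne (by lia)] at this
    simpa using this
  · have := pow_weightedShift_coord_forward α w hw n (EllTwo.single j f) j (α^[n] x)
    rw [iterate_symm_iterate, EllTwo.coord_single_self] at this
    rw [this, norm_mul]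
    by_cases hx : α^[n] x ∈ K
    · exact mul_le_mul (h _ hx) (norm_apply_le f _) (norm_nonneg _) hδ
    · rw [hf _ hx, norm_zero, mul_zero]
      positivity

theorem norm_single_le_of_pow_weightedShift_eq (α : X ≃ₜ X) (w : ℤ → X →ᵇ ℂ)
    (hw : BddAbove (Set.range fun j => ‖w j‖)) {K : Set X} {j : ℤ} {f g : C₀(X, ℂ)}
    (hf : ∀ x ∉ K, f x = 0) {n : ℕ} {δ : ℝ} (hδ : 0 ≤ δ)
    (hne : ∀ t, backwardWeight α w j n t ≠ 0)
    (h : ∀ t ∈ K, ‖(backwardWeight α w j n t)⁻¹‖ ≤ δ)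
    (hg : (weightedShift α w hw ^ n) (EllTwo.single (j - n) g) = EllTwo.single j f) :
    ‖EllTwo.single (j - n) g‖ ≤ δ * ‖f‖ := by
  refine (EllTwo.norm_single_le _ _).trans (norm_le_of_forall (by positivity) fun x => ?_)
  have := pow_weightedShift_coord_backward α w hw n (EllTwo.single (j - n) g) j (α.symm^[n] x)
  rw [hg, iterate_iterate_symm, EllTwo.coord_single_self, EllTwo.coord_single_self] at this
  rw [show g x = (backwardWeight α w j n (α.symm^[n] x))⁻¹ * f (α.symm^[n] x) by
    rw [this, inv_mul_cancel_left₀ (hne _)], norm_mul]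
  by_cases hx : α.symm^[n] x ∈ K
  · exact mul_le_mul (h _ hx) (norm_apply_le f _) (norm_nonneg _) hδ
  · rw [hf _ hx, norm_zero, mul_zero]
    positivity

/-- One sequence `r` serves the whole box, and both properties pass to linear combinations, so
single entries suffice. -/
theorem WeightCondition.exists_tendsto [Nonempty X] {α : X ≃ₜ X} {w : ℤ → X →ᵇ ℂ}
    (h : WeightCondition α w) (hw : BddAbove (Set.range fun j => ‖w j‖))
    (hw₀ : ∀ j x, w j x ≠ 0) {C : ℝ} (hC : ∀ j x, ‖(w j x)⁻¹‖ ≤ C) (q : ℕ) {K : Set X}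
    (hK : IsCompact K) :
    ∃ r : ℕ → ℕ, ∀ a ∈ boxSpan X 1 q K,
      Tendsto (fun k => (weightedShift α w hw ^ r k) a) atTop (𝓝 0) ∧
      ∃ z : ℕ → EllTwo X, Tendsto z atTop (𝓝 0) ∧ ∀ k, (weightedShift α w hw ^ r k) (z k) = a := by
  obtain ⟨x₀⟩ := ‹Nonempty X›
  -- Adding `x₀` and the index `q + 1` keeps both sets non-empty when `K = ∅` or `q = 0`.
  obtain ⟨r, -, -, hr⟩ := h (insert x₀ K) ⟨x₀, Set.mem_insert _ _⟩ (hK.insert x₀)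
    (Finset.Icc 1 (q + 1)) ⟨1, by simp⟩ fun j hj => (Finset.mem_Icc.1 hj).1
  refine ⟨r, fun a ha => ?_⟩
  induction ha using Submodule.span_induction with
  | mem a h =>
    obtain ⟨j, f, hj₁, hj₂, hf, rfl⟩ := h
    lift j to ℕ using by lia
    obtain ⟨hr₁, hr₂⟩ := hr j (Finset.mem_Icc.2 (by lia))
    rw [tendsto_biSup_nhds_zero_iff] at hr₁ hr₂
    have hne : ∀ n t, backwardWeight α w j n t ≠ 0 := fun n t =>
      Finset.prod_ne_zero_iff.2 fun i _ => hw₀ _ _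
    -- The `+ 1` covers `f = 0`.
    have hf' : 0 < ‖f‖ + 1 := by positivity
    have hlt : ∀ ε : ℝ, 0 < ε → ε / (‖f‖ + 1) * ‖f‖ < ε := fun ε hε => by
      rw [div_mul_eq_mul_div, div_lt_iff₀ hf']
      linarith
    choose g hg using fun k => exists_pow_weightedShift_single_eq α w hw hC hw₀ (r k) j f
    refine ⟨?_, fun k => EllTwo.single (j - r k) (g k), ?_, hg⟩
    · refine NormedAddGroup.tendsto_nhds_zero.2 fun ε hε => ?_
      have hδ : 0 < ε / (‖f‖ + 1) := by positivity
      filter_upwards [hr₁ _ hδ] with k hk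
      refine (norm_pow_weightedShift_single_le α w hw hf hδ.le fun t ht => ?_).trans_lt (hlt ε hε)
      have := hk t (Set.mem_insert_of_mem _ ht)
      rwa [enorm_finsetProd, enorm_le_ofReal_iff hδ.le] at this
    · refine NormedAddGroup.tendsto_nhds_zero.2 fun ε hε => ?_
      have hδ : 0 < ε / (‖f‖ + 1) := by positivity
      filter_upwards [hr₂ _ hδ] with k hk
      refine (norm_single_le_of_pow_weightedShift_eq α w hw hf hδ.le (hne _)
        (fun t ht => ?_) (hg k)).trans_lt (hlt ε hε)
      have := hk t (Set.mem_insert_of_mem _ ht)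
      rwa [prod_inv_enorm (hne _ _), enorm_le_ofReal_iff hδ.le] at this
  | zero => exact ⟨by simp, 0, tendsto_const_nhds, by simp⟩
  | add a b _ _ iha ihb =>
    obtain ⟨ha, y, hy, hya⟩ := iha
    obtain ⟨hb, z, hz, hzb⟩ := ihb
    exact ⟨by simpa using ha.add hb, fun k => y k + z k, by simpa using hy.add hz, fun k => by
      rw [map_add, hya, hzb]⟩
  | smul c a _ iha =>
    obtain ⟨ha, y, hy, hya⟩ := iha
    exact ⟨by simpa using ha.const_smul c, fun k => c • y k, by simpa using hy.const_smul c, fun k => by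
      rw [map_smul, hya]⟩

theorem WeightCondition.isHypercyclic [LocallyCompactSpace X] [T2Space X] {α : X ≃ₜ X}
    {w : ℤ → X →ᵇ ℂ} (h : WeightCondition α w) (hw : BddAbove (Set.range fun j => ‖w j‖))
    [TopologicalSpace.SeparableSpace (EllTwo X)]
    (hw₀ : ∀ j x, w j x ≠ 0) {C : ℝ} (hC : ∀ j x, ‖(w j x)⁻¹‖ ≤ C) :
    IsHypercyclic (weightedShift α w hw) := by
  rcases isEmpty_or_nonempty X with hX | hX
  · refine ⟨0, fun b => subset_closure ⟨0, ?_⟩⟩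
    ext j x
    exact hX.elim x
  have hC₀ : 0 ≤ C := (norm_nonneg _).trans (hC 0 hX.some)
  set T := weightedShift α w hw with hT
  have below := norm_le_mul_norm_pow_weightedShift α w hw hC hw₀ hC₀
  rw [← hT] at below
  have inj : ∀ n : ℕ, Function.Injective (T ^ n) := fun n => by
    refine (injective_iff_map_eq_zero (T ^ n)).2 fun a ha => ?_
    have := below n a
    rw [ha, norm_zero, mul_zero] at this
    exact norm_le_zero_iff.1 this
  have tendsto_zero : ∀ (n : ℕ) (y : ℕ → EllTwo X), Tendsto (fun k => (T ^ n) (y k)) atTop (𝓝 0) →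
      Tendsto y atTop (𝓝 0) := fun n y hy =>
    squeeze_zero_norm (fun k => below n (y k)) (by simpa using hy.norm.const_mul (C ^ n))
  have comm : ∀ (m n : ℕ) a, (T ^ m) ((T ^ n) a) = (T ^ n) ((T ^ m) a) := fun m n a => by
    rw [← mul_apply_eq_comp, ← mul_apply_eq_comp, ← pow_add, ← pow_add, add_comm]
  refine isHypercyclic_of_transitive fun U V hU hUne hV hVne => ?_
  obtain ⟨u, hu, huU⟩ := dense_compactSpan.exists_mem_open hU hUne
  obtain ⟨v, hv, hvV⟩ := dense_compactSpan.exists_mem_open hV hVne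
  obtain ⟨m, K, hK, hu⟩ := exists_mem_boxSpan hu
  obtain ⟨m', K', hK', hv⟩ := exists_mem_boxSpan hv
  let M := max m m'
  -- The power `M + 1` carries the indices `[-M, M]` to `[1, 2M + 1]`, where the weight condition
  -- applies.
  obtain ⟨L, hL, hLT⟩ := exists_pow_weightedShift_mem_boxSpan α w hw (-M : ℤ) M
    (hK.union hK') (M + 1)
  rw [← hT] at hLT
  obtain ⟨r, hr⟩ := h.exists_tendsto hw hw₀ hC (2 * M + 1) hL
  rw [← hT] at hr
  have box : ∀ a ∈ boxSpan X (-M) M (K ∪ K'),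
      (T ^ (M + 1)) a ∈ boxSpan X 1 (2 * M + 1 : ℕ) L := fun a ha =>
    boxSpan_mono (by lia) (by lia) subset_rfl (hLT a ha)
  replace hu : u ∈ boxSpan X (-M) M (K ∪ K') :=
    boxSpan_mono (by lia) (by lia) Set.subset_union_left hu
  replace hv : v ∈ boxSpan X (-M) M (K ∪ K') :=
    boxSpan_mono (by lia) (by lia) Set.subset_union_right hv
  have hTu : Tendsto (fun k => (T ^ r k) u) atTop (𝓝 0) :=
    tendsto_zero (M + 1) _ <| by simpa only [comm] using (hr _ (box u hu)).1
  obtain ⟨-, z, hz, hzv⟩ := hr _ (box v hv)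
  choose y hy using fun k =>
    boxSpan_le_range_pow_weightedShift α w hw hC hw₀ (r k) _ _ _ hv
  rw [← hT] at hy
  -- Both sides have image `T ^ (M + 1) v` under the injective `T ^ r k`, so `z k → 0` transfers to
  -- `y k`.
  have hyz : ∀ k, (T ^ (M + 1)) (y k) = z k := fun k => inj (r k) <| by
    rw [comm, hy, hzv]
  have hy₀ : Tendsto y atTop (𝓝 0) := tendsto_zero (M + 1) y <| by simpa only [hyz] using hz
  have h₁ : Tendsto (fun k => u + y k) atTop (𝓝 u) := by simpa using hy₀.const_add u
  have h₂ : Tendsto (fun k => (T ^ r k) (u + y k)) atTop (𝓝 v) := by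
    simpa only [map_add, hy, zero_add] using hTu.add_const v
  obtain ⟨k, hk₁, hk₂⟩ :=
    ((h₁.eventually (hU.mem_nhds huU)).and (h₂.eventually (hV.mem_nhds hvV))).exists
  exact ⟨r k, u + y k, hk₁, hk₂⟩

end HilbertShift

end

theorem corollary2p4 {X : Type*} [TopologicalSpace X] [LocallyCompactSpace X] [T2Space X]
    (α : X ≃ₜ X) (w : ℤ → X →ᵇ ℂ) (hw : BddAbove (Set.range fun j => ‖w j‖)) :
    (HilbertShift.IsHypercyclic (HilbertShift.weightedShift α w hw) →
      HilbertShift.WeightCondition α w) ∧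
    (TopologicalSpace.SeparableSpace (HilbertShift.EllTwo X) →
      (∀ j x, 0 < w j x) →
      (∃ C : ℝ, ∀ j x, ‖(w j x)⁻¹‖ ≤ C) →
      HilbertShift.WeightCondition α w →
      HilbertShift.IsHypercyclic (HilbertShift.weightedShift α w hw)) :=
  ⟨fun h => h.weightCondition, fun _ hpos ⟨_, hC⟩ h =>
    h.isHypercyclic hw (fun j x => (hpos j x).ne') hC⟩
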